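/- Let $\mathbb{N}=\{1,2,\dots\}$, $[n]=\{1,\dots,n\}$, and let $X^*$ denote the free monoid on $X$. Inserting a symbol $k$ into a labelled binary tree by right strict (respectively, left strict) leaf insertion means: into the empty tree, create a vertex labelled $k$; at a root labelled $x$, insert recursively into the left subtree if $k\le x$ (respectively, $k<x$), and into the right subtree otherwise. For $u\in\mathbb{N}^*$, let $P(u)$ be the tree obtained from the empty tree by right strict insertion of the symbols of $u$ read from right to left, let $P_\#(u)$ be the tree obtained from the empty tree by left strict insertion of the symbols of $u$ read from left to right, and write $u\equiv v$ if $P(u)=P(v)$ and $P_\#(u)=P_\#(v)$. The relation $\equiv$ is a congruence. The Baxter monoid is $\mathsf{baxt}=\mathbb{N}^*/{\equiv}$, and the Baxter monoid of rank $n\ge 1$ is $\mathsf{baxt}_n=[n]^*/{\equiv}$, with the restricted congruence. A variety of monoids is a class of monoids closed under homomorphic images, submonoids and arbitrary direct products. A monoid $M$ satisfies the identity $u=v$, where $u,v$ are words over an alphabet $X$ of variables, if $\varphi(u)=\varphi(v)$ for every monoid homomorphism $\varphi:X^*\to M$. **Theorem.** The variety of monoids generated by the Baxter monoids is defined by the two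 identities $$xayb\,xy\,cxdy = xayb\,yx\,cxdy\qquad\text{and}\qquad xayb\,xy\,cydx = xayb\,yx\,cydx,$$ that is, it is the class of all monoids satisfying both identities. Here the variety may be taken to be generated by all the Baxter monoids $\mathsf{baxt}$ and $\mathsf{baxt}_n$ ($n\ge1$) together, by $\mathsf{baxt}$ alone, or by $\mathsf{baxt}_n$ alone for any one $n\ge 2$. -/

import Mathlib

universe u

/-! ### Varieties of monoids -/

/-- A variety of monoids: a class of monoids closed under homomorphic images, submonoids and
direct products (of arbitrary, possibly empty, families). -/
structure IsMonoidVariety (V : Set MonCat.{u}) : Prop where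
  image_mem : ∀ M ∈ V, ∀ (N : MonCat.{u}) (f : M →* N), Function.Surjective f → N ∈ V
  submonoid_mem : ∀ M ∈ V, ∀ S : Submonoid M, MonCat.of S ∈ V
  prod_mem : ∀ (ι : Type u) (M : ι → MonCat.{u}), (∀ i, M i ∈ V) → MonCat.of (∀ i, M i) ∈ V

/-- The variety generated by a class `K` of monoids: the smallest variety containing `K`. -/
def generatedVariety (K : Set MonCat.{u}) : Set MonCat.{u} :=
  ⋂₀ {V | IsMonoidVariety V ∧ K ⊆ V}

theorem isMonoidVariety_generatedVariety (K : Set MonCat.{u}) :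
    IsMonoidVariety (generatedVariety K) where
  image_mem M hM N f hf V hV := hV.1.image_mem M (hM V hV) N f hf
  submonoid_mem M hM S V hV := hV.1.submonoid_mem M (hM V hV) S
  prod_mem ι M hM V hV := hV.1.prod_mem ι M fun i => hM i V hV

theorem subset_generatedVariety (K : Set MonCat.{u}) : K ⊆ generatedVariety K :=
  fun _ hM _ hV => hV.2 hM

/-- An identity `u = v` over the alphabet of variables `X`, given as the pair of words `(u, v)`. -/
abbrev WordIdentity (X : Type) : Type := FreeMonoid X × FreeMonoid X

/-- A monoid satisfies `u = v` if every homomorphism from the free monoid on the variables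
identifies `u` and `v`. -/
def WordIdentity.SatisfiedBy {X : Type} (e : WordIdentity X) (M : Type*) [Monoid M] : Prop :=
  ∀ φ : FreeMonoid X →* M, φ e.1 = φ e.2

/-- The class of monoids defined by a set of identities. -/
def definedBy {X : Type} (E : Set (WordIdentity X)) : Set MonCat.{u} :=
  {M | ∀ e ∈ E, e.SatisfiedBy M}

/-! ### Binary search trees and the Baxter monoids -/

/-- Right strict leaf insertion. -/
def rightStrictInsert (k : ℕ+) : BinaryTree ℕ+ → BinaryTree ℕ+
  | .nil => .node k .nil .nil
  | .node x l r =>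
    if k ≤ x then .node x (rightStrictInsert k l) r else .node x l (rightStrictInsert k r)

/-- Left strict leaf insertion. -/
def leftStrictInsert (k : ℕ+) : BinaryTree ℕ+ → BinaryTree ℕ+
  | .nil => .node k .nil .nil
  | .node x l r =>
    if x ≤ k then .node x l (leftStrictInsert k r) else .node x (leftStrictInsert k l) r

/-- The right strict binary search tree of a word: symbols are inserted into the empty tree,
proceeding right-to-left through the word. -/
def sylvTree (w : FreeMonoid ℕ+) : BinaryTree ℕ+ :=
  w.toList.foldr rightStrictInsert .nil

/-- The left strict binary search tree of a word: symbols are inserted into the empty tree,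
proceeding left-to-right through the word. -/
def sylvSharpTree (w : FreeMonoid ℕ+) : BinaryTree ℕ+ :=
  w.toList.foldl (fun t k => leftStrictInsert k t) .nil

/-- The pair of twin binary search trees of a word. -/
def baxterPair (w : FreeMonoid ℕ+) : BinaryTree ℕ+ × BinaryTree ℕ+ :=
  (sylvSharpTree w, sylvTree w)

/-! The relation `baxterPair w = baxterPair w'` is a congruence. The proof shows that the tree of
a word determines the tree of each restriction of the word to the symbols at most (greater than,
less than, at least) `x`, hence the effect of inserting the word into any tree. -/

namespace BaxterAux

def lowPart (p : ℕ+ → Bool) : BinaryTree ℕ+ → BinaryTree ℕ+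
  | .nil => .nil
  | .node y l r => if p y then .node y l (lowPart p r) else lowPart p l

def highPart (p : ℕ+ → Bool) : BinaryTree ℕ+ → BinaryTree ℕ+
  | .nil => .nil
  | .node y l r => if p y then .node y (highPart p l) r else highPart p r

theorem lowPart_right (x k : ℕ+) (t : BinaryTree ℕ+) :
    lowPart (fun y => decide (y ≤ x)) (rightStrictInsert k t) =
      if k ≤ x then rightStrictInsert k (lowPart (fun y => decide (y ≤ x)) t)
      else lowPart (fun y => decide (y ≤ x)) t := by
  induction t with
  | nil => by_cases h : k ≤ x <;> simp [rightStrictInsert, lowPart, h]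
  | node y l r ihl ihr =>
    grind [rightStrictInsert, lowPart]

theorem highPart_right (x k : ℕ+) (t : BinaryTree ℕ+) :
    highPart (fun y => decide (x < y)) (rightStrictInsert k t) =
      if x < k then rightStrictInsert k (highPart (fun y => decide (x < y)) t)
      else highPart (fun y => decide (x < y)) t := by
  induction t with
  | nil => by_cases h : x < k <;> simp [rightStrictInsert, highPart, h]
  | node y l r ihl ihr =>
    grind [rightStrictInsert, highPart]

theorem lowPart_left (x k : ℕ+) (t : BinaryTree ℕ+) :
    lowPart (fun y => decide (y < x)) (leftStrictInsert k t) =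
      if k < x then leftStrictInsert k (lowPart (fun y => decide (y < x)) t)
      else lowPart (fun y => decide (y < x)) t := by
  induction t with
  | nil => by_cases h : k < x <;> simp [leftStrictInsert, lowPart, h]
  | node y l r ihl ihr =>
    grind [leftStrictInsert, lowPart]

theorem highPart_left (x k : ℕ+) (t : BinaryTree ℕ+) :
    highPart (fun y => decide (x ≤ y)) (leftStrictInsert k t) =
      if x ≤ k then leftStrictInsert k (highPart (fun y => decide (x ≤ y)) t)
      else highPart (fun y => decide (x ≤ y)) t := by
  induction t with
  | nil => by_cases h : x ≤ k <;> simp [leftStrictInsert, highPart, h]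
  | node y l r ihl ihr =>
    grind [leftStrictInsert, highPart]

/-- Inserting a list from right to left commutes with restriction. -/
theorem foldr_restrict (ins : ℕ+ → BinaryTree ℕ+ → BinaryTree ℕ+) (p : ℕ+ → Bool)
    (g : BinaryTree ℕ+ → BinaryTree ℕ+) (hnil : g .nil = .nil)
    (h : ∀ k t, g (ins k t) = if p k then ins k (g t) else g t) (w : List ℕ+) :
    g (w.foldr ins .nil) = (w.filter p).foldr ins .nil := by
  induction w with
  | nil => simpa using hnil
  | cons k w ih => by_cases hk : p k <;> simp [h, hk, ih]

theorem foldr_right_node (x : ℕ+) (l r : BinaryTree ℕ+) (w : List ℕ+) :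
    w.foldr rightStrictInsert (.node x l r) =
      .node x ((w.filter fun y => decide (y ≤ x)).foldr rightStrictInsert l)
        ((w.filter fun y => decide (x < y)).foldr rightStrictInsert r) := by
  induction w with
  | nil => rfl
  | cons k w ih =>
    by_cases hk : k ≤ x
    · simp [ih, rightStrictInsert, hk, not_lt.2 hk]
    · simp [ih, rightStrictInsert, hk, not_le.1 hk]

theorem foldr_left_node (x : ℕ+) (l r : BinaryTree ℕ+) (w : List ℕ+) :
    w.foldr leftStrictInsert (.node x l r) =
      .node x ((w.filter fun y => decide (y < x)).foldr leftStrictInsert l)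
        ((w.filter fun y => decide (x ≤ y)).foldr leftStrictInsert r) := by
  induction w with
  | nil => rfl
  | cons k w ih =>
    by_cases hk : x ≤ k
    · simp [ih, leftStrictInsert, hk, not_lt.2 hk]
    · simp [ih, leftStrictInsert, hk, not_le.1 hk]

theorem foldr_right_congr (t : BinaryTree ℕ+) : ∀ w w' : List ℕ+,
    w.foldr rightStrictInsert .nil = w'.foldr rightStrictInsert .nil →
      w.foldr rightStrictInsert t = w'.foldr rightStrictInsert t := by
  induction t with
  | nil => exact fun _ _ h => h
  | node x l r ihl ihr =>
    intro w w' h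
    rw [foldr_right_node, foldr_right_node]
    congr 1
    · apply ihl
      have key := foldr_restrict _ (fun y => decide (y ≤ x)) (lowPart fun y => decide (y ≤ x)) rfl
        (by simpa using lowPart_right x)
      rw [← key, ← key, h]
    · apply ihr
      have key := foldr_restrict _ (fun y => decide (x < y)) (highPart fun y => decide (x < y)) rfl
        (by simpa using highPart_right x)
      rw [← key, ← key, h]

theorem foldr_left_congr (t : BinaryTree ℕ+) : ∀ w w' : List ℕ+,
    w.foldr leftStrictInsert .nil = w'.foldr leftStrictInsert .nil →
      w.foldr leftStrictInsert t = w'.foldr leftStrictInsert t := by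
  induction t with
  | nil => exact fun _ _ h => h
  | node x l r ihl ihr =>
    intro w w' h
    rw [foldr_left_node, foldr_left_node]
    congr 1
    · apply ihl
      have key := foldr_restrict _ (fun y => decide (y < x)) (lowPart fun y => decide (y < x)) rfl
        (by simpa using lowPart_left x)
      rw [← key, ← key, h]
    · apply ihr
      have key := foldr_restrict _ (fun y => decide (x ≤ y)) (highPart fun y => decide (x ≤ y)) rfl
        (by simpa using highPart_left x)
      rw [← key, ← key, h]

end BaxterAux

theorem sylvTree_mul_congr {w x y z : FreeMonoid ℕ+} (h₁ : sylvTree w = sylvTree x)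
    (h₂ : sylvTree y = sylvTree z) : sylvTree (w * y) = sylvTree (x * z) := by
  simp only [sylvTree, FreeMonoid.toList_mul, List.foldr_append] at *
  rw [h₂]
  exact BaxterAux.foldr_right_congr _ _ _ h₁

theorem sylvSharpTree_mul_congr {w x y z : FreeMonoid ℕ+}
    (h₁ : sylvSharpTree w = sylvSharpTree x) (h₂ : sylvSharpTree y = sylvSharpTree z) :
    sylvSharpTree (w * y) = sylvSharpTree (x * z) := by
  simp only [sylvSharpTree, FreeMonoid.toList_mul,
    List.foldl_eq_foldr_reverse, List.reverse_append, List.foldr_append] at *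
  rw [h₁]
  exact BaxterAux.foldr_left_congr _ _ _ h₂

/-- The Baxter congruence on words over the positive integers. -/
def baxterCon : Con (FreeMonoid ℕ+) where
  r w w' := baxterPair w = baxterPair w'
  iseqv := ⟨fun _ => rfl, fun h => h.symm, fun h h' => h.trans h'⟩
  mul' h h' := by
    simp only [baxterPair, Prod.mk.injEq] at *
    exact ⟨sylvSharpTree_mul_congr h.1 h'.1, sylvTree_mul_congr h.2 h'.2⟩

/-- The (infinite-rank) Baxter monoid. -/
abbrev BaxterMonoid : Type := baxterCon.Quotient

/-- The restriction of the Baxter congruence to words over `[n] = {1, …, n}`. -/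
def baxterConRank (n : ℕ+) : Con (FreeMonoid (Set.Iic n)) :=
  Con.comap (FreeMonoid.map Subtype.val) (map_mul _) baxterCon

/-- The Baxter monoid of rank `n`. -/
abbrev BaxterMonoidRank (n : ℕ+) : Type := (baxterConRank n).Quotient

/-- The class of all Baxter monoids, of infinite rank and of each finite rank (lifted to an
arbitrary universe). -/
def baxterMonoids : Set MonCat.{u} :=
  {MonCat.of (ULift.{u} BaxterMonoid)} ∪
    Set.range fun n : ℕ+ => MonCat.of (ULift.{u} (BaxterMonoidRank n))

/-! ### The two identities -/

/-- The six variables of the identities. -/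
inductive BaxterVar : Type
  | x | y | a | b | c | d

namespace BaxterVar

/-- A word, from the list of its letters. -/
abbrev word (l : List BaxterVar) : FreeMonoid BaxterVar := FreeMonoid.ofList l

end BaxterVar

open BaxterVar in
/-- `xayb xy cxdy = xayb yx cxdy`. -/
def baxterIdentity₁ : WordIdentity BaxterVar :=
  (word [x, a, y, b, x, y, c, x, d, y], word [x, a, y, b, y, x, c, x, d, y])

open BaxterVar in
/-- `xayb xy cydx = xayb yx cydx`. -/
def baxterIdentity₂ : WordIdentity BaxterVar :=
  (word [x, a, y, b, x, y, c, y, d, x], word [x, a, y, b, y, x, c, y, d, x])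

/-! The identities hold in every Baxter monoid because swapping adjacent factors `x`, `y` changes
neither tree when every letter of both also occurs before and after them (`baxterCon_swap`): two
distinct letters are separated by a node already in the tree, so the order of their insertion is
irrelevant.

Conversely, an identity of a Baxter monoid of rank at least two preserves the number of each letter,
the number of `y` after the last `x`, and the number of `y` before the first `x`; spines of trees on
the labels 1, 2 record these numbers. If two sides agree up to a prefix `p` and then continue with
`a :: s` and `t ++ a :: q`, where `a` is not in the nonempty `t`, these invariants force `a` and all
letters of `t` to occur in both `p` and `q` (`mem_of_append`). The two identities then move `a` to
the left across `t`, and induction on the common prefix derives the whole identity (`prod_eq`). The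
easy direction of Birkhoff's theorem and a relatively free monoid convert this into equality of
classes. -/

/-! ### Insertion of permuted words -/

namespace BaxterAux

/-- The last letter `z` of `q` is the root. Either it separates `a` from `b`, and their insertions
do not interact, or `a`, `b` and `c` all lie on one side of it and `c` survives in the shorter word
sent to that subtree. -/
theorem foldr_right_swap {a b c : ℕ+} (hac : a ≤ c) (hcb : c < b) :
    ∀ (n : ℕ) (q : List ℕ+), q.length ≤ n → c ∈ q →
      (a :: b :: q).foldr rightStrictInsert .nil = (b :: a :: q).foldr rightStrictInsert .nil := by
  intro n
  induction n with
  | zero => intro q hq hc; simp_all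
  | succ n ih =>
    intro q hq hc
    rcases List.eq_nil_or_concat q with rfl | ⟨q, z, rfl⟩
    · simp at hc
    simp only [List.concat_eq_append] at hq hc ⊢
    rw [← List.cons_append, ← List.cons_append, ← List.cons_append, ← List.cons_append,
      List.foldr_append, List.foldr_append]
    rw [show [z].foldr rightStrictInsert .nil = .node z .nil .nil from rfl, foldr_right_node,
      foldr_right_node]
    have hlen : ∀ p : ℕ+ → Bool, (q.filter p).length ≤ n := fun p =>
      (List.length_filter_le _ _).trans (by simpa using hq)
    have hc' : c = z ∨ c ∈ q := by simpa [or_comm] using hc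
    by_cases hbz : b ≤ z
    · have haz : a ≤ z := (hac.trans hcb.le).trans hbz
      have hcz : c ≤ z := hcb.le.trans hbz
      have hcq : c ∈ q := hc'.resolve_left (hcb.trans_le hbz).ne
      simp only [List.filter_cons, haz, hbz, not_lt.2 haz, not_lt.2 hbz, decide_true,
        decide_false, if_true]
      rw [ih _ (hlen _) (by simp [hcq, hcz])]
      rfl
    · by_cases haz : a ≤ z
      · simp [List.filter_cons, haz, hbz, not_lt.2 haz]
      · have hcz : z < c := (not_le.1 haz).trans_le hac
        have hcq : c ∈ q := hc'.resolve_left hcz.ne'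
        simp only [List.filter_cons, haz, hbz, not_le.1 haz, not_le.1 hbz, decide_true,
          decide_false, if_true]
        rw [ih _ (hlen _) (by simp [hcq, hcz])]
        rfl

theorem foldr_left_swap {a b c : ℕ+} (hac : a < c) (hcb : c ≤ b) :
    ∀ (n : ℕ) (q : List ℕ+), q.length ≤ n → c ∈ q →
      (a :: b :: q).foldr leftStrictInsert .nil = (b :: a :: q).foldr leftStrictInsert .nil := by
  intro n
  induction n with
  | zero => intro q hq hc; simp_all
  | succ n ih =>
    intro q hq hc
    rcases List.eq_nil_or_concat q with rfl | ⟨q, z, rfl⟩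
    · simp at hc
    simp only [List.concat_eq_append] at hq hc ⊢
    rw [← List.cons_append, ← List.cons_append, ← List.cons_append, ← List.cons_append,
      List.foldr_append, List.foldr_append]
    rw [show [z].foldr leftStrictInsert .nil = .node z .nil .nil from rfl, foldr_left_node,
      foldr_left_node]
    have hlen : ∀ p : ℕ+ → Bool, (q.filter p).length ≤ n := fun p =>
      (List.length_filter_le _ _).trans (by simpa using hq)
    have hc' : c = z ∨ c ∈ q := by simpa [or_comm] using hc
    by_cases haz : z ≤ a
    · have hbz : z ≤ b := haz.trans (hac.le.trans hcb)
      have hcz : z < c := haz.trans_lt hac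
      have hcq : c ∈ q := hc'.resolve_left hcz.ne'
      simp only [List.filter_cons, haz, hbz, not_lt.2 haz, not_lt.2 hbz, decide_true,
        decide_false, if_true]
      rw [if_neg (by simp), if_neg (by simp), if_neg (by simp), if_neg (by simp),
        ih _ (hlen _) (by simp [hcq, hcz.le])]
    · by_cases hbz : z ≤ b
      · simp [List.filter_cons, haz, hbz, not_lt.2 hbz]
      · have hcz : c < z := hcb.trans_lt (not_le.1 hbz)
        have hcq : c ∈ q := hc'.resolve_left hcz.ne
        simp only [List.filter_cons, haz, hbz, not_le.1 haz, not_le.1 hbz, decide_true,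
          decide_false, if_true]
        rw [ih _ (hlen _) (by simp [hcq, hcz])]
        rfl

/-- Permuting an inserted word does not change the tree if swapping two distinct letters of the
tree does not. -/
theorem foldr_perm (ins : ℕ+ → BinaryTree ℕ+ → BinaryTree ℕ+)
    (hswap : ∀ (a b : ℕ+) (q : List ℕ+), a < b → a ∈ q → b ∈ q →
      (a :: b :: q).foldr ins .nil = (b :: a :: q).foldr ins .nil)
    {w w' : List ℕ+} (h : w.Perm w') (q : List ℕ+) (hw : ∀ k ∈ w, k ∈ q) :
    (w ++ q).foldr ins .nil = (w' ++ q).foldr ins .nil := by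
  induction h with
  | nil => rfl
  | cons k _ ih => simp only [List.cons_append, List.foldr_cons, ih fun j hj => hw j (by simp [hj])]
  | swap a b l =>
    have ha : a ∈ l ++ q := by simp [hw a]
    have hb : b ∈ l ++ q := by simp [hw b]
    rcases lt_trichotomy a b with hab | rfl | hab
    · exact (hswap a b (l ++ q) hab ha hb).symm
    · rfl
    · exact hswap b a (l ++ q) hab hb ha
  | trans h₁ _ ih₁ ih₂ => exact (ih₁ hw).trans (ih₂ fun k hk => hw k (h₁.mem_iff.2 hk))

end BaxterAux

theorem sylvTree_swap (x y q : FreeMonoid ℕ+) (hx : ∀ k ∈ x.toList, k ∈ q.toList)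
    (hy : ∀ k ∈ y.toList, k ∈ q.toList) : sylvTree (x * y * q) = sylvTree (y * x * q) := by
  simp only [sylvTree, FreeMonoid.toList_mul]
  -- The separating label is the smaller letter itself, since equal labels go left.
  refine BaxterAux.foldr_perm _ (fun a b q hab ha _ =>
    BaxterAux.foldr_right_swap le_rfl hab _ q le_rfl ha) List.perm_append_comm _ ?_
  intro k hk
  rcases List.mem_append.1 hk with hk | hk
  exacts [hx k hk, hy k hk]

theorem sylvSharpTree_swap (x y p : FreeMonoid ℕ+) (hx : ∀ k ∈ x.toList, k ∈ p.toList)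
    (hy : ∀ k ∈ y.toList, k ∈ p.toList) :
    sylvSharpTree (p * (x * y)) = sylvSharpTree (p * (y * x)) := by
  simp only [sylvSharpTree, FreeMonoid.toList_mul, List.foldl_eq_foldr_reverse,
    List.reverse_append]
  -- Here equal labels go right, so the larger letter separates.
  refine BaxterAux.foldr_perm _ (fun a b q hab _ hb =>
    BaxterAux.foldr_left_swap hab le_rfl _ q le_rfl hb) List.perm_append_comm _ ?_
  intro k hk
  rw [List.mem_reverse]
  rcases List.mem_append.1 hk with hk | hk
  exacts [hy k (List.mem_reverse.1 hk), hx k (List.mem_reverse.1 hk)]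

/-- The prefix `p` protects the left strict tree and the suffix `q` the right strict one. -/
theorem baxterCon_swap (p x y q : FreeMonoid ℕ+)
    (hxp : ∀ k ∈ x.toList, k ∈ p.toList) (hyp : ∀ k ∈ y.toList, k ∈ p.toList)
    (hxq : ∀ k ∈ x.toList, k ∈ q.toList) (hyq : ∀ k ∈ y.toList, k ∈ q.toList) :
    baxterCon (p * (x * y) * q) (p * (y * x) * q) := by
  change baxterPair _ = baxterPair _
  refine Prod.ext (sylvSharpTree_mul_congr (sylvSharpTree_swap x y p hxp hyp) rfl) ?_
  simp only [baxterPair]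
  rw [mul_assoc p, mul_assoc p]
  exact sylvTree_mul_congr rfl (sylvTree_swap x y q hxq hyq)

/-! ### The identities in the Baxter monoids -/

theorem WordIdentity.SatisfiedBy.of_injective {X : Type} {e : WordIdentity X} {M N : Type*}
    [Monoid M] [Monoid N] (h : e.SatisfiedBy M) (f : N →* M) (hf : Function.Injective f) :
    e.SatisfiedBy N :=
  fun φ => hf (h (f.comp φ))

theorem FreeMonoid.exists_lift_of_surjective {X : Type*} {M N : Type*} [Monoid M] [Monoid N]
    (f : M →* N) (hf : Function.Surjective f) (φ : FreeMonoid X →* N) :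
    ∃ ψ : FreeMonoid X →* M, f.comp ψ = φ := by
  choose g hg using hf
  exact ⟨FreeMonoid.lift fun x => g (φ (.of x)), FreeMonoid.hom_eq fun x => by simp [hg]⟩

theorem WordIdentity.SatisfiedBy.of_surjective {X : Type} {e : WordIdentity X} {M N : Type*}
    [Monoid M] [Monoid N] (h : e.SatisfiedBy M) (f : M →* N) (hf : Function.Surjective f) :
    e.SatisfiedBy N := by
  intro φ
  obtain ⟨ψ, rfl⟩ := FreeMonoid.exists_lift_of_surjective f hf φ
  exact congrArg f (h ψ)

theorem baxterIdentity₁_satisfiedBy_iff {M : Type*} [Monoid M] :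
    baxterIdentity₁.SatisfiedBy M ↔ ∀ x y a b c d : M,
      x * a * y * b * (x * y) * (c * x * d * y) = x * a * y * b * (y * x) * (c * x * d * y) := by
  constructor
  · intro h x y a b c d
    have := h (FreeMonoid.lift fun v => BaxterVar.rec x y a b c d v)
    simpa [baxterIdentity₁, FreeMonoid.lift_ofList, mul_assoc] using this
  · intro h φ
    have := h (φ (.of .x)) (φ (.of .y)) (φ (.of .a)) (φ (.of .b)) (φ (.of .c)) (φ (.of .d))
    simpa [baxterIdentity₁, FreeMonoid.ofList_cons, mul_assoc] using this

theorem baxterIdentity₂_satisfiedBy_iff {M : Type*} [Monoid M] :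
    baxterIdentity₂.SatisfiedBy M ↔ ∀ x y a b c d : M,
      x * a * y * b * (x * y) * (c * y * d * x) = x * a * y * b * (y * x) * (c * y * d * x) := by
  constructor
  · intro h x y a b c d
    have := h (FreeMonoid.lift fun v => BaxterVar.rec x y a b c d v)
    simpa [baxterIdentity₂, FreeMonoid.lift_ofList, mul_assoc] using this
  · intro h φ
    have := h (φ (.of .x)) (φ (.of .y)) (φ (.of .a)) (φ (.of .b)) (φ (.of .c)) (φ (.of .d))
    simpa [baxterIdentity₂, FreeMonoid.ofList_cons, mul_assoc] using this

/-- A monoid satisfies both Baxter identities. -/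
def SatisfiesBaxterIdentities (M : Type*) [Monoid M] : Prop :=
  baxterIdentity₁.SatisfiedBy M ∧ baxterIdentity₂.SatisfiedBy M

theorem mem_definedBy_baxterIdentities {M : MonCat.{u}} :
    M ∈ definedBy {baxterIdentity₁, baxterIdentity₂} ↔ SatisfiesBaxterIdentities M := by
  simp [definedBy, SatisfiesBaxterIdentities]

theorem BaxterMonoid.satisfiesBaxterIdentities : SatisfiesBaxterIdentities BaxterMonoid := by
  constructor
  · rw [baxterIdentity₁_satisfiedBy_iff]
    intro x y a b c d
    induction x using Con.induction_on with | _ x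
    induction y using Con.induction_on with | _ y
    induction a using Con.induction_on with | _ a
    induction b using Con.induction_on with | _ b
    induction c using Con.induction_on with | _ c
    induction d using Con.induction_on with | _ d
    simp only [← Con.coe_mul]
    apply (Con.eq _).2
    apply baxterCon_swap <;> intro k hk <;> simp [FreeMonoid.toList_mul, hk]
  · rw [baxterIdentity₂_satisfiedBy_iff]
    intro x y a b c d
    induction x using Con.induction_on with | _ x
    induction y using Con.induction_on with | _ y
    induction a using Con.induction_on with | _ a
    induction b using Con.induction_on with | _ b
    induction c using Con.induction_on with | _ c
    induction d using Con.induction_on with | _ d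
    simp only [← Con.coe_mul]
    apply (Con.eq _).2
    apply baxterCon_swap <;> intro k hk <;> simp [FreeMonoid.toList_mul, hk]

/-- The inclusion of the Baxter monoid of rank `n` into the Baxter monoid. -/
def BaxterMonoidRank.inclusion (n : ℕ+) : BaxterMonoidRank n →* BaxterMonoid :=
  Con.lift _ (baxterCon.mk'.comp (FreeMonoid.map Subtype.val)) fun _ _ h => (Con.eq _).2 h

theorem BaxterMonoidRank.inclusion_injective (n : ℕ+) :
    Function.Injective (BaxterMonoidRank.inclusion n) := by
  intro x y h
  induction x using Con.induction_on with | _ x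
  induction y using Con.induction_on with | _ y
  exact (Con.eq _).2 ((Con.eq baxterCon).1 h)

theorem BaxterMonoidRank.satisfiesBaxterIdentities (n : ℕ+) :
    SatisfiesBaxterIdentities (BaxterMonoidRank n) :=
  ⟨BaxterMonoid.satisfiesBaxterIdentities.1.of_injective _ (inclusion_injective n),
    BaxterMonoid.satisfiesBaxterIdentities.2.of_injective _ (inclusion_injective n)⟩

theorem SatisfiesBaxterIdentities.ulift {M : Type*} [Monoid M] (h : SatisfiesBaxterIdentities M) :
    SatisfiesBaxterIdentities (ULift.{u} M) :=
  ⟨h.1.of_injective (MulEquiv.ulift : ULift.{u} M ≃* M).toMonoidHom ULift.down_injective,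
    h.2.of_injective (MulEquiv.ulift : ULift.{u} M ≃* M).toMonoidHom ULift.down_injective⟩

/-! ### Identities and generated varieties -/

theorem isMonoidVariety_definedBy {X : Type} (E : Set (WordIdentity X)) :
    IsMonoidVariety (definedBy.{u} E) where
  image_mem _ hM _ f hf e he := (hM e he).of_surjective f hf
  submonoid_mem _ hM S e he := (hM e he).of_injective S.subtype Subtype.val_injective
  prod_mem _ M hM e he φ := funext fun i => hM i e he ((Pi.evalMonoidHom (fun i => M i) i).comp φ)

theorem generatedVariety_subset {K V : Set MonCat.{u}} (hV : IsMonoidVariety V) (h : K ⊆ V) :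
    generatedVariety K ⊆ V :=
  fun _ hM => hM V ⟨hV, h⟩

theorem generatedVariety_mono {K L : Set MonCat.{u}} (h : K ⊆ L) :
    generatedVariety K ⊆ generatedVariety L :=
  generatedVariety_subset (isMonoidVariety_generatedVariety L)
    (h.trans (subset_generatedVariety L))

/-- A monoid satisfying all identities of `B` lies in the variety generated by `B`. -/
theorem mem_generatedVariety_of_identities (B M : MonCat.{u})
    (h : ∀ v w : FreeMonoid M, (∀ φ : FreeMonoid M →* B, φ v = φ w) →
      FreeMonoid.lift id v = FreeMonoid.lift id w) :
    M ∈ generatedVariety {B} := by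
  have hV := isMonoidVariety_generatedVariety {B}
  -- The image of `FreeMonoid M` in this power of `B` is relatively free on the set `M`; by `h` the
  -- evaluation `G` factors through it.
  let P : MonCat.{u} := MonCat.of ((FreeMonoid M →* B) → B)
  have hP : P ∈ generatedVariety {B} :=
    hV.prod_mem (FreeMonoid M →* B) (fun _ => B) fun _ => subset_generatedVariety _ rfl
  let F : FreeMonoid M →* P := MonoidHom.pi fun φ => φ
  have hF := hV.submonoid_mem P hP (MonoidHom.mrange F)
  let G : FreeMonoid M →* M := FreeMonoid.lift id
  have hker : ∀ v w, F v = F w → G v = G w := fun v w hvw => h v w fun φ => congrFun hvw φ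
  have hspec : ∀ z : MonoidHom.mrange F, F z.2.choose = z := fun z => z.2.choose_spec
  let f : MonoidHom.mrange F →* M :=
    { toFun := fun z => G z.2.choose
      map_one' := by
        rw [← map_one G]
        exact hker _ _ (by rw [hspec, map_one]; rfl)
      map_mul' := fun y z => by
        rw [← map_mul G]
        exact hker _ _ (by rw [hspec, map_mul, hspec, hspec]; rfl) }
  refine hV.image_mem _ hF M f fun m => ⟨⟨F (.of m), .of m, rfl⟩, ?_⟩
  change G _ = m
  rw [hker _ (.of m) (hspec _)]
  simp [G]

/-! ### Consequences of the identities -/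

/-- Four cases, by the order of chosen occurrences of `x` and `y` in `p` and in `q`. When `y` comes
first in `p`, the roles are exchanged and the identity is read backwards. -/
theorem SatisfiesBaxterIdentities.mul_swap {M X : Type*} [Monoid M]
    (hM : SatisfiesBaxterIdentities M) (f : X → M) {x y : X} {p q : List X}
    (hxp : x ∈ p) (hyp : y ∈ p) (hxq : x ∈ q) (hyq : y ∈ q) :
    (p.map f).prod * (f x * f y) * (q.map f).prod =
      (p.map f).prod * (f y * f x) * (q.map f).prod := by
  by_cases hxy : x = y
  · rw [hxy]
  have h₁ := baxterIdentity₁_satisfiedBy_iff.1 hM.1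
  have h₂ := baxterIdentity₂_satisfiedBy_iff.1 hM.2
  have split : ∀ l : List X, x ∈ l → y ∈ l →
      (∃ l₁ l₂ l₃, l = l₁ ++ x :: (l₂ ++ y :: l₃)) ∨ ∃ l₁ l₂ l₃, l = l₁ ++ y :: (l₂ ++ x :: l₃) := by
    intro l hx hy
    obtain ⟨s, t, rfl⟩ := List.append_of_mem hx
    have hy' : y ∈ s ∨ y ∈ t := by simpa [Ne.symm hxy] using hy
    rcases hy' with hy' | hy'
    · obtain ⟨s₁, s₂, rfl⟩ := List.append_of_mem hy'
      exact Or.inr ⟨s₁, s₂, t, by simp⟩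
    · obtain ⟨s₁, s₂, rfl⟩ := List.append_of_mem hy'
      exact Or.inl ⟨s, s₁, s₂, by simp⟩
  rcases split p hxp hyp with ⟨p₁, p₂, p₃, rfl⟩ | ⟨p₁, p₂, p₃, rfl⟩ <;>
  rcases split q hxq hyq with ⟨q₁, q₂, q₃, rfl⟩ | ⟨q₁, q₂, q₃, rfl⟩
  · have := congrArg (fun z => (p₁.map f).prod * z * (q₃.map f).prod)
      (h₁ (f x) (f y) (p₂.map f).prod (p₃.map f).prod (q₁.map f).prod (q₂.map f).prod)
    simpa [mul_assoc] using this
  · have := congrArg (fun z => (p₁.map f).prod * z * (q₃.map f).prod)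
      (h₂ (f x) (f y) (p₂.map f).prod (p₃.map f).prod (q₁.map f).prod (q₂.map f).prod)
    simpa [mul_assoc] using this
  · have := congrArg (fun z => (p₁.map f).prod * z * (q₃.map f).prod)
      (h₂ (f y) (f x) (p₂.map f).prod (p₃.map f).prod (q₁.map f).prod (q₂.map f).prod).symm
    simpa [mul_assoc] using this
  · have := congrArg (fun z => (p₁.map f).prod * z * (q₃.map f).prod)
      (h₁ (f y) (f x) (p₂.map f).prod (p₃.map f).prod (q₁.map f).prod (q₂.map f).prod).symm
    simpa [mul_assoc] using this

/-- A letter may be moved to the left across a word if it and the letters of the word occur both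
before and after. -/
theorem SatisfiesBaxterIdentities.prod_move {M X : Type*} [Monoid M]
    (hM : SatisfiesBaxterIdentities M) (f : X → M) {a : X} {p t q : List X}
    (hap : a ∈ p) (haq : a ∈ q) (htp : ∀ z ∈ t, z ∈ p) (htq : ∀ z ∈ t, z ∈ q) :
    ((p ++ t ++ a :: q).map f).prod = ((p ++ a :: (t ++ q)).map f).prod := by
  induction t generalizing p with
  | nil => simp
  | cons z t ih =>
    have h₁ := ih (p := p ++ [z]) (by simp [hap])
      (fun k hk => by simp [htp k (List.mem_cons_of_mem _ hk)])
      (fun k hk => htq k (List.mem_cons_of_mem _ hk))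
    have h₂ := hM.mul_swap f (x := z) (y := a) (p := p) (q := t ++ q) (htp z (by simp)) hap
      (by simp [htq z]) (by simp [haq])
    simp only [List.map_append, List.map_cons, List.prod_append, List.prod_cons, List.map_nil,
      List.prod_nil, mul_one, mul_assoc] at h₁ h₂ ⊢
    rw [h₁, h₂]

/-! ### Invariants read off from the rank two Baxter monoid -/

namespace BaxterAux

/-- The number of labels `k` at the top of the left spine. -/
def leftRun (k : ℕ+) : BinaryTree ℕ+ → ℕ
  | .nil => 0
  | .node x l _ => if x = k then leftRun k l + 1 else 0

/-- The number of labels `k` at the top of the right spine. -/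
def rightRun (k : ℕ+) : BinaryTree ℕ+ → ℕ
  | .nil => 0
  | .node x _ r => if x = k then rightRun k r + 1 else 0

/-- A label other than `k` occurs on the left spine. -/
def leftStop (k : ℕ+) : BinaryTree ℕ+ → Prop
  | .nil => False
  | .node x l _ => x ≠ k ∨ leftStop k l

/-- A label other than `k` occurs on the right spine. -/
def rightStop (k : ℕ+) : BinaryTree ℕ+ → Prop
  | .nil => False
  | .node x _ r => x ≠ k ∨ rightStop k r

/-- A new leaf can extend the left spine only at its bottom, below the label that ends the run. -/
theorem leftRun_insert_of_stop {k j : ℕ+} {t : BinaryTree ℕ+} (ht : leftStop k t) :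
    leftRun k (rightStrictInsert j t) = leftRun k t ∧ leftStop k (rightStrictInsert j t) := by
  induction t with
  | nil => exact ht.elim
  | node x l r ihl _ => grind [leftStop, leftRun, rightStrictInsert]

theorem rightRun_insert_of_stop {k j : ℕ+} {t : BinaryTree ℕ+} (ht : rightStop k t) :
    rightRun k (leftStrictInsert j t) = rightRun k t ∧ rightStop k (leftStrictInsert j t) := by
  induction t with
  | nil => exact ht.elim
  | node x l r _ ihr => grind [rightStop, rightRun, leftStrictInsert]

/-- The left spine carries only `k`, so `j` descends along all of it and becomes its new bottom. -/
theorem leftRun_insert {k j : ℕ+} (hjk : j ≤ k) {t : BinaryTree ℕ+} (ht : ¬ leftStop k t) :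
    leftRun k (rightStrictInsert j t) = leftRun k t + (if j = k then 1 else 0) ∧
      (leftStop k (rightStrictInsert j t) ↔ j ≠ k) := by
  induction t with
  | nil => by_cases h : j = k <;> simp [leftStop, leftRun, rightStrictInsert, h]
  | node x l r ihl _ =>
    grind [leftStop, leftRun, rightStrictInsert]

theorem rightRun_insert {k j : ℕ+} (hjk : k ≤ j) {t : BinaryTree ℕ+} (ht : ¬ rightStop k t) :
    rightRun k (leftStrictInsert j t) = rightRun k t + (if j = k then 1 else 0) ∧
      (rightStop k (leftStrictInsert j t) ↔ j ≠ k) := by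
  induction t with
  | nil => by_cases h : j = k <;> simp [rightStop, rightRun, leftStrictInsert, h]
  | node x l r _ ihr =>
    grind [rightStop, rightRun, leftStrictInsert]

theorem leftRun_replicate (k : ℕ+) (m : ℕ) :
    leftRun k ((List.replicate m k).foldr rightStrictInsert .nil) = m ∧
      ¬ leftStop k ((List.replicate m k).foldr rightStrictInsert .nil) := by
  induction m with
  | zero => simp [leftRun, leftStop]
  | succ m ih =>
    have := leftRun_insert le_rfl ih.2
    simp only [List.replicate_succ, List.foldr_cons]
    simpa [ih.1] using this

theorem rightRun_replicate (k : ℕ+) (m : ℕ) :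
    rightRun k ((List.replicate m k).foldr leftStrictInsert .nil) = m ∧
      ¬ rightStop k ((List.replicate m k).foldr leftStrictInsert .nil) := by
  induction m with
  | zero => simp [rightRun, rightStop]
  | succ m ih =>
    have := rightRun_insert le_rfl ih.2
    simp only [List.replicate_succ, List.foldr_cons]
    simpa [ih.1] using this

theorem leftRun_foldr {k j : ℕ+} (hjk : j < k) (m : ℕ) (w : List ℕ+) :
    leftRun k ((w ++ j :: List.replicate m k).foldr rightStrictInsert .nil) = m := by
  suffices h : leftRun k ((w ++ j :: List.replicate m k).foldr rightStrictInsert .nil) = m ∧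
      leftStop k ((w ++ j :: List.replicate m k).foldr rightStrictInsert .nil) from h.1
  induction w with
  | nil =>
    have h := leftRun_replicate k m
    have := leftRun_insert hjk.le h.2
    simpa [h.1, hjk.ne] using this
  | cons i w ih =>
    have := leftRun_insert_of_stop (j := i) ih.2
    rw [ih.1] at this
    exact this

theorem rightRun_foldr {k j : ℕ+} (hjk : k < j) (m : ℕ) (w : List ℕ+) :
    rightRun k ((w ++ j :: List.replicate m k).foldr leftStrictInsert .nil) = m := by
  suffices h : rightRun k ((w ++ j :: List.replicate m k).foldr leftStrictInsert .nil) = m ∧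
      rightStop k ((w ++ j :: List.replicate m k).foldr leftStrictInsert .nil) from h.1
  induction w with
  | nil =>
    have h := rightRun_replicate k m
    have := rightRun_insert hjk.le h.2
    simpa [h.1, hjk.ne'] using this
  | cons i w ih =>
    have := rightRun_insert_of_stop (j := i) ih.2
    rw [ih.1] at this
    exact this

end BaxterAux

/-! ### Identities of the Baxter monoid of rank `n` -/

/-- The words `v` and `w` form an identity of the Baxter monoid of rank `n`. -/
def IsBaxterIdentity {X : Type*} (n : ℕ+) (v w : List X) : Prop :=
  ∀ f : X → BaxterMonoidRank n, (v.map f).prod = (w.map f).prod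

namespace IsBaxterIdentity

variable {X : Type*} {n : ℕ+} {v w : List X}

theorem baxterPair_eq (h : IsBaxterIdentity n v w) (f : X → List ℕ+)
    (hf : ∀ x, ∀ k ∈ f x, k ≤ n) :
    baxterPair (FreeMonoid.ofList (v.flatMap f)) = baxterPair (FreeMonoid.ofList (w.flatMap f)) := by
  let g : X → FreeMonoid (Set.Iic n) := fun x =>
    FreeMonoid.ofList ((f x).attach.map fun k => ⟨k.1, hf x k.1 k.2⟩)
  have hg : ∀ l : List X, FreeMonoid.map Subtype.val (l.map g).prod =
      FreeMonoid.ofList (l.flatMap f) := by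
    intro l
    induction l with
    | nil => rfl
    | cons x l ih =>
      rw [List.map_cons, List.prod_cons, map_mul, ih, List.flatMap_cons, FreeMonoid.ofList_append]
      congr 1
      simp [g, ← FreeMonoid.ofList_map, List.map_map, Function.comp_def]
  have key := h fun x => ((g x : FreeMonoid (Set.Iic n)) : BaxterMonoidRank n)
  have hm : ∀ l : List X, (l.map fun x => ((g x : FreeMonoid (Set.Iic n)) : BaxterMonoidRank n)).prod
      = (((l.map g).prod : FreeMonoid (Set.Iic n)) : BaxterMonoidRank n) := by
    intro l
    induction l with
    | nil => rfl
    | cons x l ih => simp only [List.map_cons, List.prod_cons, ih, Con.coe_mul]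
  rw [hm, hm] at key
  have := (Con.eq (baxterConRank n)).1 key
  change baxterPair _ = baxterPair _ at this
  rwa [hg, hg] at this

open Classical in
theorem flatMap_pair_eq_replicate (x y : X) (i j : ℕ+) {l : List X} (hx : x ∉ l) :
    (l.flatMap fun z => if z = x then [i] else if z = y then [j] else []) =
      List.replicate (l.count y) j := by
  induction l with
  | nil => rfl
  | cons z l ih =>
    have hzx : z ≠ x := fun hz => hx (by simp [hz])
    rw [List.flatMap_cons, ih fun hl => hx (by simp [hl])]
    by_cases hzy : z = y
    · subst hzy
      simp [hzx, List.replicate_succ]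
    · simp [hzx, hzy]

open Classical in
theorem count_eq (h : IsBaxterIdentity n v w) (y : X) : v.count y = w.count y := by
  have hflat : ∀ l : List X, (l.flatMap fun z => if z = y then [(1 : ℕ+)] else []) =
      List.replicate (l.count y) 1 := by
    intro l
    induction l with
    | nil => rfl
    | cons z l ih =>
      rw [List.flatMap_cons, ih]
      by_cases hzy : z = y
      · subst hzy
        simp [List.replicate_succ]
      · simp [hzy]
  have := h.baxterPair_eq (fun z => if z = y then [1] else []) fun z k hk => by
    split_ifs at hk <;> simp_all
  rw [hflat, hflat] at this
  have h₂ := congrArg (fun p => BaxterAux.leftRun 1 p.2) this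
  simpa [baxterPair, sylvTree, (BaxterAux.leftRun_replicate 1 _).1] using h₂

-- Substitute 1 for `x`, 2 for `y` and erase the rest. Read from the right, the copies of 2 met
-- before the first 1 form the run on the left spine.
open Classical in
theorem count_after_last (h : IsBaxterIdentity n v w) (hn : 2 ≤ n) {x y : X} {p q p' q' : List X}
    (hv : v = p ++ x :: q) (hw : w = p' ++ x :: q') (hq : x ∉ q) (hq' : x ∉ q') :
    q.count y = q'.count y := by
  have := h.baxterPair_eq (fun z => if z = x then [1] else if z = y then [2] else [])
    fun z k hk => by
      split_ifs at hk <;> simp_all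
  have h₂ := congrArg (fun p => BaxterAux.leftRun 2 p.2) this
  simp only [baxterPair, sylvTree, FreeMonoid.toList_ofList, hv, hw, List.flatMap_append,
    List.flatMap_cons, if_true, flatMap_pair_eq_replicate _ _ _ _ hq,
    flatMap_pair_eq_replicate _ _ _ _ hq', List.singleton_append] at h₂
  rwa [BaxterAux.leftRun_foldr (by decide), BaxterAux.leftRun_foldr (by decide)] at h₂

open Classical in
theorem count_before_first (h : IsBaxterIdentity n v w) (hn : 2 ≤ n) {x y : X}
    {p q p' q' : List X}
    (hv : v = p ++ x :: q) (hw : w = p' ++ x :: q') (hp : x ∉ p) (hp' : x ∉ p') :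
    p.count y = p'.count y := by
  have := h.baxterPair_eq (fun z => if z = x then [2] else if z = y then [1] else [])
    fun z k hk => by
      split_ifs at hk <;> simp_all
  have h₂ := congrArg (fun p => BaxterAux.rightRun 1 p.1) this
  simp only [baxterPair, sylvSharpTree, FreeMonoid.toList_ofList, hv, hw, List.flatMap_append,
    List.flatMap_cons, if_true, flatMap_pair_eq_replicate _ _ _ _ hp,
    flatMap_pair_eq_replicate _ _ _ _ hp', List.singleton_append, List.foldl_eq_foldr_reverse,
    List.reverse_append, List.reverse_cons, List.reverse_replicate, List.append_assoc] at h₂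
  rwa [BaxterAux.rightRun_foldr (by decide), BaxterAux.rightRun_foldr (by decide)] at h₂

open Classical in
/-- If `p a s = p t a q` is an identity with `t` nonempty and not containing `a`, then `a` and the
letters of `t` occur both in `p` and in `q`. -/
theorem mem_of_append {a : X} {p s t q : List X} (hn : 2 ≤ n)
    (h : IsBaxterIdentity n (p ++ a :: s) (p ++ t ++ a :: q)) (hat : a ∉ t) (ht : t ≠ []) :
    a ∈ p ∧ a ∈ q ∧ (∀ z ∈ t, z ∈ p) ∧ ∀ z ∈ t, z ∈ q := by
  obtain ⟨b, hb⟩ := List.exists_mem_of_ne_nil t ht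
  have hne : ∀ z ∈ t, z ≠ a := fun z hz hza => hat (hza ▸ hz)
  have hcount := h.count_eq
  have hmem : ∀ z ∈ t, z ∈ s := by
    intro z hz
    have h₁ := hcount z
    have h₂ := List.count_pos_iff.2 hz
    simp only [List.count_append, List.count_cons_of_ne (hne z hz).symm] at h₁
    exact List.count_pos_iff.1 (by omega)
  refine ⟨?_, ?_, ?_, ?_⟩
  -- Otherwise the first `a` is preceded by `p` on one side and by `p ++ t` on the other, which
  -- differ in the count of `b`.
  · by_contra ha
    have h₁ := h.count_before_first hn (y := b) rfl rfl ha (by simp [ha, hat])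
    have h₂ := List.count_pos_iff.2 hb
    rw [List.count_append] at h₁
    omega
  -- Otherwise the displayed `a` is the last on both sides, and the words after it differ in the
  -- count of `b`.
  · by_contra ha
    have h₀ := hcount a
    simp only [List.count_append, List.count_cons_self, List.count_eq_zero.2 hat,
      List.count_eq_zero.2 ha] at h₀
    have has : a ∉ s := List.count_eq_zero.1 (by omega)
    have h₁ := h.count_after_last hn (y := b) rfl rfl has ha
    have h₂ := List.count_pos_iff.2 hb
    have h₃ := hcount b
    simp only [List.count_append, List.count_cons_of_ne (hne b hb).symm] at h₃
    omega
  -- If `z` is not in `p`, its first occurrence comes after the displayed `a` on the left side but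
  -- before it on the right side.
  · intro z hz
    by_contra hzp
    obtain ⟨r₁, r₂, hr, hzr⟩ := List.eq_append_cons_of_mem hz
    obtain ⟨s₁, s₂, hs, hzs⟩ := List.eq_append_cons_of_mem (hmem z hz)
    subst hr hs
    have h₁ := h.count_before_first hn (x := z) (y := a) (p := p ++ a :: s₁) (q := s₂)
      (p' := p ++ r₁) (q' := r₂ ++ a :: q) (by simp) (by simp)
      (by simp [hzp, hzs, hne z hz]) (by simp [hzp, hzr])
    have har : a ∉ r₁ := fun hr => hat (by simp [hr])
    simp only [List.count_append, List.count_cons_self, List.count_eq_zero.2 har] at h₁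
    omega
  -- If `z` is not in `q`, its last occurrence on the right is in `t`, followed by one more `a` than
  -- `q` has; on the left at most the copies in `s` follow, and `s` has as many as `q`. Reversal
  -- locates last occurrences.
  · intro z hz
    by_contra hzq
    obtain ⟨r₂, r₁, hr, hzr⟩ := List.eq_append_cons_of_mem (List.mem_reverse.2 hz)
    obtain ⟨s₂, s₁, hs, hzs⟩ :=
      List.eq_append_cons_of_mem (List.mem_reverse.2 (hmem z hz))
    obtain rfl : t = r₁.reverse ++ z :: r₂.reverse := by
      simpa using congrArg List.reverse hr
    obtain rfl : s = s₁.reverse ++ z :: s₂.reverse := by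
      simpa using congrArg List.reverse hs
    have h₁ := h.count_after_last hn (x := z) (y := a) (p := p ++ a :: s₁.reverse)
      (q := s₂.reverse) (p' := p ++ r₁.reverse) (q' := r₂.reverse ++ a :: q)
      (by simp) (by simp) (by simp [hzs]) (by simp [hzr, hzq, hne z hz])
    have h₀ := hcount a
    have hat' := List.count_eq_zero.2 hat
    simp only [List.count_append, List.count_cons_self, List.count_cons_of_ne (hne z hz)]
      at h₀ h₁ hat'
    omega

/-- Identities of a Baxter monoid of rank at least two are consequences of the two identities. -/
theorem prod_eq (hn : 2 ≤ n) {M : Type*} [Monoid M] (hM : SatisfiesBaxterIdentities M)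
    (f : X → M) (s : List X) : ∀ p r : List X, IsBaxterIdentity n (p ++ s) (p ++ r) →
      ((p ++ s).map f).prod = ((p ++ r).map f).prod := by
  classical
  induction s with
  | nil =>
    intro p r h
    suffices hr : r = [] by rw [hr]
    rw [List.eq_nil_iff_forall_not_mem]
    intro z hz
    have h₁ := h.count_eq z
    have h₂ := List.count_pos_iff.2 hz
    simp only [List.count_append, List.count_nil] at h₁
    omega
  | cons a s ih =>
    intro p r h
    have har : a ∈ r := by
      have h₁ := h.count_eq a
      simp only [List.count_append, List.count_cons_self] at h₁
      exact List.count_pos_iff.1 (by omega)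
    obtain ⟨t, q, rfl, hat⟩ := List.eq_append_cons_of_mem har
    rcases eq_or_ne t [] with rfl | ht
    · simpa using ih (p ++ [a]) q (by simpa using h)
    rw [← List.append_assoc] at h ⊢
    obtain ⟨h₁, h₂, h₃, h₄⟩ := mem_of_append hn h hat ht
    rw [hM.prod_move f h₁ h₂ h₃ h₄]
    -- The rewritten word still gives a Baxter identity, because the same move is valid in the
    -- Baxter monoid.
    simpa using ih (p ++ [a]) (t ++ q) fun g => by
      simpa using (h g).trans
        ((BaxterMonoidRank.satisfiesBaxterIdentities n).prod_move g h₁ h₂ h₃ h₄)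

end IsBaxterIdentity

/-! ### The generated varieties -/

theorem definedBy_subset_generatedVariety {n : ℕ+} (hn : 2 ≤ n) {B : Type} [Monoid B]
    (j : BaxterMonoidRank n →* B) (hj : Function.Injective j) :
    definedBy {baxterIdentity₁, baxterIdentity₂} ⊆
      generatedVariety {MonCat.of (ULift.{u} B)} := by
  intro M hM
  refine mem_generatedVariety_of_identities _ M fun v w h => ?_
  have hid : IsBaxterIdentity n v.toList w.toList := fun f => by
    have := h ((MulEquiv.ulift : ULift.{u} B ≃* B).symm.toMonoidHom.comp
      (j.comp (FreeMonoid.lift f)))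
    simpa [FreeMonoid.lift_apply] using hj (ULift.up_injective this)
  simpa [FreeMonoid.lift_apply] using
    IsBaxterIdentity.prod_eq hn (mem_definedBy_baxterIdentities.1 hM) id v.toList [] w.toList hid

theorem generatedVariety_eq_definedBy {n : ℕ+} (hn : 2 ≤ n) {B : Type} [Monoid B]
    (hB : SatisfiesBaxterIdentities B) (j : BaxterMonoidRank n →* B)
    (hj : Function.Injective j) :
    generatedVariety {MonCat.of (ULift.{u} B)} =
      definedBy {baxterIdentity₁, baxterIdentity₂} := by
  refine (generatedVariety_subset (isMonoidVariety_definedBy _) ?_).antisymm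
    (definedBy_subset_generatedVariety hn j hj)
  rintro _ rfl
  exact mem_definedBy_baxterIdentities.2 hB.ulift

theorem mainTheorem12 :
    generatedVariety baxterMonoids.{u} = definedBy {baxterIdentity₁, baxterIdentity₂} ∧
    generatedVariety {MonCat.of (ULift.{u} BaxterMonoid)} =
      definedBy {baxterIdentity₁, baxterIdentity₂} ∧
    ∀ n : ℕ+, 2 ≤ n →
      generatedVariety {MonCat.of (ULift.{u} (BaxterMonoidRank n))} =
        definedBy {baxterIdentity₁, baxterIdentity₂} := by
  have h := generatedVariety_eq_definedBy.{u} le_rfl BaxterMonoid.satisfiesBaxterIdentities _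
    (BaxterMonoidRank.inclusion_injective 2)
  refine ⟨?_, h, fun n hn => generatedVariety_eq_definedBy hn
    (BaxterMonoidRank.satisfiesBaxterIdentities n) (MonoidHom.id _) Function.injective_id⟩
  -- The class of all Baxter monoids contains `BaxterMonoid`, which already generates everything.
  refine (generatedVariety_subset (isMonoidVariety_definedBy _) ?_).antisymm
    (h.symm.subset.trans (generatedVariety_mono Set.subset_union_left))
  rintro _ (rfl | ⟨n, rfl⟩)
  · exact mem_definedBy_baxterIdentities.2 BaxterMonoid.satisfiesBaxterIdentities.ulift
  · exact mem_definedBy_baxterIdentities.2 (BaxterMonoidRank.satisfiesBaxterIdentities n).ulift
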